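/- Let $N\ge 0$ and consider the totally asymmetric simple exclusion process on $\mathbb{Z}$ with $N$ particles: each particle attempts, independently and at rate $1$, to hop one site to the right, and a hop is suppressed if the target site is occupied. Label the particles $1,\dots,N$ from the left, let $y_1<\dots<y_N$ be their positions at time $0$, and write $P(x_1,\dots,x_N;t\,|\,y_1,\dots,y_N;0)$ for the probability that they are at $x_1<\dots<x_N$ at time $t\ge 0$. For integers $n,m$ put $$F_n(m;t)=e^{-t}\sum_{k\ge 0,\ m+k\ge 0}\frac{(n)_k}{k!}\,\frac{t^{m+k}}{(m+k)!},\qquad (n)_k=n(n+1)\cdots(n+k-1),$$ which for $m\ge 0$ equals $e^{-t}\frac{t^m}{m!}\sum_{k=0}^\infty\frac{(n)_k}{(m+1)_k}\frac{t^k}{k!}$. Then for all integers $X_1\le X_2\le\dots\le X_N$, the probability that every particle $j$ ($1\le j\le N$) has hopped at least $X_j-y_j$ steps by time $t$, that is, that its position at time $t$ is at least $X_j$, is $$\sum_{\substack{x_1<\dots<x_N\\ X_j\le x_j\ (1\le j\le N)}}P(x_1,\dots,x_N;t\,|\,y_1,\dots,y_N;0)=\det\bigl[F_{k-j+1}(X_k-y_j;t)\bigr]_{j,k=1}^N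 .$$ -/

import Mathlib

open MeasureTheory Filter Topology
open scoped NNReal BoundedContinuousFunction

noncomputable section

namespace TASEP

/-- Configurations of `N` labelled particles on `ℤ`, at most one per site, labelled from the left:
`x 0 < x 1 < ⋯ < x (N - 1)`. -/
abbrev Config (N : ℕ) : Type := {x : Fin N → ℤ // StrictMono x}

/-- The site to the right of particle `j` is occupied. -/
def Blocked {N : ℕ} (x : Config N) (j : Fin N) : Prop := ∃ i, x.1 i = x.1 j + 1

theorem strictMono_update {N : ℕ} (x : Config N) (j : Fin N) (h : ¬ Blocked x j) :
    StrictMono (Function.update x.1 j (x.1 j + 1)) := by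
  intro a b hab
  have hx : x.1 a < x.1 b := x.2 hab
  by_cases ha : a = j
  · subst ha
    have hb : b ≠ a := hab.ne'
    have hne : x.1 b ≠ x.1 a + 1 := fun e => h ⟨b, e⟩
    simp only [Function.update_self, Function.update_of_ne hb]
    omega
  · by_cases hb : b = j
    · subst hb
      simp only [Function.update_self, Function.update_of_ne ha]
      omega
    · simpa only [Function.update_of_ne ha, Function.update_of_ne hb] using hx

open Classical in
/-- The configuration after particle `j` has attempted to hop one step to the right: the hop is
performed if the target site is empty and suppressed otherwise. -/
def hop {N : ℕ} (x : Config N) (j : Fin N) : Config N :=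
  if h : Blocked x j then x else ⟨Function.update x.1 j (x.1 j + 1), strictMono_update x j h⟩

theorem abs_generator_le {N : ℕ} (f : Config N →ᵇ ℝ) (x : Config N) :
    ‖∑ j, (f (hop x j) - f x)‖ ≤ 2 * N * ‖f‖ := by
  calc ‖∑ j, (f (hop x j) - f x)‖ ≤ ∑ _j : Fin N, 2 * ‖f‖ := by
        refine norm_sum_le_of_le _ fun j _ => ?_
        have h1 := f.norm_coe_le_norm (hop x j)
        have h2 := f.norm_coe_le_norm x
        have h3 := norm_sub_le (f (hop x j)) (f x)
        linarith
    _ = 2 * N * ‖f‖ := by simp; ring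

/-- The generator of the process in which each particle attempts to hop one step to the right at
rate `1`, as a bounded operator on the bounded functions of the configuration:
`(L f)(x) = ∑ j, (f (hop x j) - f x)`. (The set of configurations is discrete.) -/
def generator (N : ℕ) : (Config N →ᵇ ℝ) →L[ℝ] (Config N →ᵇ ℝ) :=
  LinearMap.mkContinuous
    { toFun := fun f => BoundedContinuousFunction.ofNormedAddCommGroupDiscrete
        (fun x => ∑ j, (f (hop x j) - f x)) (2 * N * ‖f‖) (abs_generator_le f)
      map_add' := by
        intro f g
        ext x
        simp only [BoundedContinuousFunction.coe_ofNormedAddCommGroupDiscrete,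
          BoundedContinuousFunction.coe_add, Pi.add_apply, ← Finset.sum_add_distrib]
        exact Finset.sum_congr rfl fun j _ => by ring
      map_smul' := by
        intro c f
        ext x
        simp only [BoundedContinuousFunction.coe_ofNormedAddCommGroupDiscrete,
          BoundedContinuousFunction.coe_smul, smul_eq_mul, RingHom.id_apply, Finset.mul_sum]
        exact Finset.sum_congr rfl fun j _ => by ring }
    (2 * N) (fun f => by
      refine (BoundedContinuousFunction.norm_le (by positivity)).2 fun x => ?_
      exact abs_generator_le f x)

set_option maxSynthPendingDepth 5 in
instance instIsTopologicalRingOperators (N : ℕ) :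
    IsTopologicalRing ((Config N →ᵇ ℝ) →L[ℝ] (Config N →ᵇ ℝ)) := inferInstance

/-- The Markov semigroup `exp (t L)`. -/
def semigroup (N : ℕ) (t : ℝ) : (Config N →ᵇ ℝ) →L[ℝ] (Config N →ᵇ ℝ) :=
  NormedSpace.exp (t • generator N)

open Classical in
/-- The indicator function of a single configuration. -/
def single {N : ℕ} (x : Config N) : Config N →ᵇ ℝ :=
  BoundedContinuousFunction.ofNormedAddCommGroupDiscrete (fun z => if z = x then (1 : ℝ) else 0) 1
    (fun z => by split_ifs <;> simp)

/-- The transition probability `P(x; t | y; 0)`. -/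
def transitionProb {N : ℕ} (x : Config N) (t : ℝ) (y : Config N) : ℝ :=
  semigroup N t (single x) y

/-- `η` is a realization, on the probability space `(Ω, μ)`, of the totally asymmetric simple
exclusion process with `N` particles started from `y`: a càdlàg Markov process (for its own
filtration) with semigroup `exp (t L)` and initial state `y`. -/
structure IsProcess {Ω : Type*} [MeasurableSpace Ω] (μ : Measure Ω) {N : ℕ} (y : Config N)
    (η : ℝ≥0 → Ω → Config N) : Prop where
  measurable : ∀ t, Measurable (η t)
  initial : ∀ᵐ ω ∂μ, η 0 ω = y
  right_continuous : ∀ᵐ ω ∂μ, ∀ t, ContinuousWithinAt (fun s => η s ω) (Set.Ici t) t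
  left_limits : ∀ᵐ ω ∂μ, ∀ t, ∃ l, Tendsto (fun s => η s ω) (𝓝[<] t) (𝓝 l)
  markov : ∀ (s t : ℝ≥0) (f : Config N →ᵇ ℝ),
    μ[fun ω => f (η (s + t) ω) | ⨆ r ∈ Set.Iic s, MeasurableSpace.comap (η r) inferInstance]
      =ᵐ[μ] fun ω => semigroup N t f (η s ω)

/-- `1 / l!` for an integer `l`, which is `0` for `l < 0`. -/
def invFactorial (l : ℤ) : ℝ := if 0 ≤ l then ((l.toNat.factorial : ℕ) : ℝ)⁻¹ else 0

/-- `F_n(m;t) = e^{-t} (t^m / m!) ∑_{k ≥ 0} (n)_k / (m+1)_k * t^k / k!` for integers `n` and `m`,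
written with `m! (m+1)_k = (m+k)!`, so that it also makes sense for `m < 0`, where the terms with
`m + k < 0` vanish. -/
def F (n m : ℤ) (t : ℝ) : ℝ :=
  Real.exp (-t) * ∑' k : ℕ, (((ascPochhammer ℤ k).eval n : ℤ) : ℝ) / (k.factorial : ℝ) *
    (t ^ (m + k).toNat * invFactorial (m + k))

/-- For `m ≥ 0`, `F` is given by the hypergeometric series in its usual form. -/
theorem F_natCast (n : ℤ) (m : ℕ) (t : ℝ) :
    F n m t = Real.exp (-t) * (t ^ m / (m.factorial : ℝ)) *
      ∑' k : ℕ, (((ascPochhammer ℤ k).eval n : ℤ) : ℝ) / (ascPochhammer ℝ k).eval ((m : ℝ) + 1) *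
        (t ^ k / (k.factorial : ℝ)) := by
  rw [F, mul_assoc]
  congr 1
  refine Eq.trans ?_ (tsum_mul_left (a := t ^ m / (m.factorial : ℝ)))
  refine tsum_congr fun k => ?_
  have h : ((m : ℤ) + k).toNat = m + k := by omega
  have h0 : (0 : ℤ) ≤ (m : ℤ) + k := by positivity
  have hm : (m.factorial : ℝ) * (ascPochhammer ℝ k).eval ((m : ℝ) + 1) = ((m + k).factorial : ℝ) := by
    rw [← Nat.factorial_mul_ascFactorial, ← ascPochhammer_nat_eq_ascFactorial]
    push_cast
    rfl
  rw [invFactorial, if_pos h0, h, ← hm, pow_add]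
  rw [mul_inv]
  ring

end TASEP

end

noncomputable section

namespace TASEP

/-! As functions of the initial configuration `y` and of `t`, the probability and the determinant
both solve the backward equation `∂ₜ u = L u` with the indicator of `upperSet X` as initial value; a
uniqueness theorem identifies them.

Row `j` of the matrix depends on `y` only through `y_j`, and `∂ₜ F_n(m) = F_n(m-1) - F_n(m)`
(`hasDerivAt_F`), so differentiating row `j` produces the increment under `y_j ↦ y_j + 1`. If that
site is occupied, then `y_{j+1} = y_j + 1`, and `F_n(m) - F_n(m+1) = F_{n-1}(m)` (`F_sub_F_add_one`)
makes the differentiated row equal to row `j+1`: the term vanishes, as exclusion demands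
(`det_transitionMatrix_hop_sub`).

At `t = 0` the matrix is unitriangular on `upperSet X` and has a large zero block off it
(`det_transitionMatrix_zero`). Its entries need not be bounded in `y`, so uniqueness is proved in a
class of exponential growth (`eq_zero_of_backward_equation`). -/

/-! ### The functions `F`: recurrence, derivative, growth and values at time zero -/

/-- `t ^ l / l!` for an integer `l`, which is `0` for `l < 0`. -/
def divPow (l : ℤ) (t : ℝ) : ℝ := t ^ l.toNat * invFactorial l

theorem divPow_natCast (l : ℕ) (t : ℝ) : divPow l t = t ^ l / (l.factorial : ℝ) := by
  simp [divPow, invFactorial, div_eq_mul_inv]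

theorem divPow_of_neg {l : ℤ} (hl : l < 0) (t : ℝ) : divPow l t = 0 := by
  simp [divPow, invFactorial, not_le.2 hl]

theorem divPow_zero_right (l : ℤ) : divPow l 0 = if l = 0 then 1 else 0 := by
  rcases lt_or_ge l 0 with hl | hl
  · rw [divPow_of_neg hl, if_neg hl.ne]
  · lift l to ℕ using hl
    rw [divPow_natCast]
    cases l with
    | zero => simp
    | succ l => rw [if_neg (by positivity)]; simp

theorem divPow_nonneg (l : ℤ) {t : ℝ} (ht : 0 ≤ t) : 0 ≤ divPow l t := by
  rcases lt_or_ge l 0 with hl | hl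
  · rw [divPow_of_neg hl]
  · lift l to ℕ using hl
    rw [divPow_natCast]
    positivity

theorem abs_divPow_le (l : ℤ) {t R : ℝ} (ht : |t| ≤ R) : |divPow l t| ≤ divPow l R := by
  rcases lt_or_ge l 0 with hl | hl
  · simp [divPow_of_neg hl]
  · lift l to ℕ using hl
    rw [divPow_natCast, divPow_natCast, abs_div, abs_pow, Nat.abs_cast]
    gcongr

theorem hasDerivAt_divPow (l : ℤ) (t : ℝ) : HasDerivAt (divPow l) (divPow (l - 1) t) t := by
  rcases lt_or_ge l 0 with hl | hl
  · rw [divPow_of_neg (by omega), show divPow l = fun _ => 0 from funext (divPow_of_neg hl)]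
    exact hasDerivAt_const t 0
  · lift l to ℕ using hl
    rw [show divPow l = fun s => s ^ l / (l.factorial : ℝ) from funext (divPow_natCast l)]
    cases l with
    | zero => simpa [divPow_of_neg] using hasDerivAt_const t (1 : ℝ)
    | succ l =>
      rw [show ((l + 1 : ℕ) : ℤ) - 1 = (l : ℕ) by push_cast; ring, divPow_natCast]
      refine ((hasDerivAt_pow (l + 1) t).div_const (((l + 1).factorial : ℕ) : ℝ)).congr_deriv ?_
      rw [Nat.factorial_succ]
      push_cast
      field_simp

theorem two_zpow_mul_divPow (l : ℤ) (t : ℝ) : (2 : ℝ) ^ l * divPow l t = divPow l (2 * t) := by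
  rcases lt_or_ge l 0 with hl | hl
  · simp [divPow_of_neg hl]
  · lift l to ℕ using hl
    rw [divPow_natCast, divPow_natCast, mul_pow, zpow_natCast]
    ring

theorem hasSum_divPow (t : ℝ) : HasSum (fun l : ℤ => divPow l t) (Real.exp t) := by
  refine (Function.Injective.hasSum_iff (g := ((↑) : ℕ → ℤ)) Nat.cast_injective ?_).1 ?_
  · intro l hl
    refine divPow_of_neg ?_ t
    by_contra! h
    exact hl ⟨l.toNat, by simpa using h⟩
  · rw [Real.exp_eq_exp_ℝ]
    simpa only [Function.comp_def, divPow_natCast] using NormedSpace.expSeries_div_hasSum_exp t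

theorem summable_divPow_add (m : ℤ) (t : ℝ) : Summable fun k : ℕ => divPow (m + k) t :=
  (hasSum_divPow t).summable.comp_injective (i := fun k : ℕ => m + (k : ℤ))
    fun a b h => by simpa using h

theorem tsum_divPow_add_le (m : ℤ) {t : ℝ} (ht : 0 ≤ t) :
    ∑' k : ℕ, divPow (m + k) t ≤ Real.exp t := by
  rw [← (hasSum_divPow t).tsum_eq]
  exact tsum_comp_le_tsum_of_inj (hasSum_divPow t).summable (fun l => divPow_nonneg l ht)
    (i := fun k : ℕ => m + (k : ℤ)) fun a b h => by simpa using h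

/-- The coefficient `(n)_k / k!` of `z ^ k` in `(1 - z) ^ (-n)`. -/
def negBinom (n : ℤ) (k : ℕ) : ℝ := (((ascPochhammer ℤ k).eval n : ℤ) : ℝ) / (k.factorial : ℝ)

@[simp] theorem negBinom_zero_right (n : ℤ) : negBinom n 0 = 1 := by simp [negBinom]

theorem negBinom_one_left (k : ℕ) : negBinom 1 k = 1 := by
  rw [negBinom, ascPochhammer_eval_one]
  push_cast
  exact div_self (by positivity)

theorem negBinom_neg_of_lt {p k : ℕ} (h : p < k) : negBinom (-p) k = 0 := by
  rw [negBinom, ascPochhammer_eval_neg_coe_nat_of_lt h]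
  simp

/-- Coefficient comparison in `(1 - z) (1 - z)^(-n) = (1 - z)^(-(n-1))`. -/
theorem negBinom_succ_sub (n : ℤ) (k : ℕ) :
    negBinom n (k + 1) - negBinom n k = negBinom (n - 1) (k + 1) := by
  have h : (ascPochhammer ℤ (k + 1)).eval (n - 1) = (n - 1) * (ascPochhammer ℤ k).eval n := by
    simp [ascPochhammer_succ_left]
  rw [negBinom, negBinom, negBinom, h, ascPochhammer_succ_eval, Nat.factorial_succ]
  push_cast
  field_simp
  ring

/-- Each factor satisfies `|n + i| ≤ p + 1 + i`, and `(p+1)_k / k!` is the binomial coefficient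
`(p+k).choose k`. -/
theorem abs_negBinom_le {n : ℤ} {p : ℕ} (hn : |n| ≤ p) (k : ℕ) :
    |negBinom n k| ≤ 2 ^ (p + k) := by
  have key : |(ascPochhammer ℤ k).eval n| ≤ ((p + 1).ascFactorial k : ℕ) := by
    induction k with
    | zero => simp
    | succ k ih =>
      rw [ascPochhammer_succ_eval, abs_mul, Nat.ascFactorial_succ, mul_comm]
      push_cast
      refine mul_le_mul ?_ ih (abs_nonneg _) (by positivity)
      rw [abs_le] at hn ⊢
      constructor <;> linarith
  rw [Nat.ascFactorial_eq_factorial_mul_choose] at key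
  rw [negBinom, abs_div, Nat.abs_cast, div_le_iff₀ (by positivity)]
  have h2 : (k.factorial * (p + k).choose k : ℕ) ≤ 2 ^ (p + k) * k.factorial := by
    rw [mul_comm]
    exact Nat.mul_le_mul_right _ (Nat.choose_le_two_pow _ _)
  exact_mod_cast key.trans (by exact_mod_cast h2)

theorem F_eq (n m : ℤ) (t : ℝ) :
    F n m t = Real.exp (-t) * ∑' k : ℕ, negBinom n k * divPow (m + k) t := rfl

/-- Split `2^(p+k) = 2^(p-m) 2^(m+k)`; the second factor is absorbed by doubling the time.
Uniformity in `|t| ≤ R` allows termwise differentiation, and the factor `2^(-m)` governs the growth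
in `y`. -/
theorem abs_negBinom_mul_divPow_le {n : ℤ} {p : ℕ} (hn : |n| ≤ p) (m : ℤ) (k : ℕ) {t R : ℝ}
    (ht : |t| ≤ R) :
    |negBinom n k * divPow (m + k) t| ≤ (2 : ℝ) ^ (p - m) * divPow (m + k) (2 * R) := by
  rw [abs_mul, ← two_zpow_mul_divPow, ← mul_assoc, ← zpow_add₀ two_ne_zero,
    show (p : ℤ) - m + (m + k) = ((p + k : ℕ) : ℤ) by push_cast; ring, zpow_natCast]
  exact mul_le_mul (abs_negBinom_le hn k) (abs_divPow_le _ ht) (abs_nonneg _) (by positivity)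

theorem summable_negBinom_mul_divPow (n m : ℤ) (t : ℝ) :
    Summable fun k : ℕ => negBinom n k * divPow (m + k) t :=
  Summable.of_norm_bounded ((summable_divPow_add m (2 * |t|)).mul_left ((2 : ℝ) ^ (n.natAbs - m)))
    fun k => abs_negBinom_mul_divPow_le (by simp) m k le_rfl

theorem abs_F_le {n : ℤ} {p : ℕ} (hn : |n| ≤ p) (m : ℤ) {t : ℝ} (ht : 0 ≤ t) :
    |F n m t| ≤ (2 : ℝ) ^ (p - m) * Real.exp t := by
  have hs := (summable_divPow_add m (2 * t)).mul_left ((2 : ℝ) ^ (p - m))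
  have hb : |∑' k : ℕ, negBinom n k * divPow (m + k) t| ≤ (2 : ℝ) ^ (p - m) * Real.exp (2 * t) := by
    refine (tsum_of_norm_bounded (f := fun k : ℕ => negBinom n k * divPow (m + k) t) hs.hasSum
      fun k => abs_negBinom_mul_divPow_le hn m k (abs_of_nonneg ht).le).trans ?_
    rw [tsum_mul_left]
    gcongr
    exact tsum_divPow_add_le m (by positivity)
  rw [F_eq, abs_mul, abs_of_pos (Real.exp_pos _)]
  calc Real.exp (-t) * |∑' k : ℕ, negBinom n k * divPow (m + k) t|
      ≤ Real.exp (-t) * ((2 : ℝ) ^ (p - m) * Real.exp (2 * t)) := by gcongr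
    _ = (2 : ℝ) ^ (p - m) * (Real.exp (-t) * Real.exp (2 * t)) := by ring
    _ = (2 : ℝ) ^ (p - m) * Real.exp t := by rw [← Real.exp_add]; ring_nf

theorem F_sub_F_add_one (n m : ℤ) (t : ℝ) : F n m t - F n (m + 1) t = F (n - 1) m t := by
  have h1 := summable_negBinom_mul_divPow n m t
  have h2 := summable_negBinom_mul_divPow n (m + 1) t
  have h3 := summable_negBinom_mul_divPow (n - 1) m t
  rw [F_eq, F_eq, F_eq, ← mul_sub, h1.tsum_eq_zero_add, h3.tsum_eq_zero_add, add_sub_assoc,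
    ← ((summable_nat_add_iff 1).2 h1).tsum_sub h2]
  simp only [negBinom_zero_right]
  congr 3
  ext k
  rw [← negBinom_succ_sub, show m + 1 + (k : ℤ) = m + ((k + 1 : ℕ) : ℤ) by push_cast; ring]
  ring

theorem hasDerivAt_F (n m : ℤ) (t : ℝ) :
    HasDerivAt (F n m) (F n (m - 1) t - F n m t) t := by
  have hs : HasDerivAt (fun s => ∑' k : ℕ, negBinom n k * divPow (m + k) s)
      (∑' k : ℕ, negBinom n k * divPow (m - 1 + k) t) t := by
    have ht : t ∈ Metric.ball (0 : ℝ) (|t| + 1) := by simp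
    refine hasDerivAt_tsum_of_isPreconnected
      (g := fun (k : ℕ) s => negBinom n k * divPow (m + k) s)
      (g' := fun (k : ℕ) s => negBinom n k * divPow (m - 1 + k) s)
      ((summable_divPow_add (m - 1) (2 * (|t| + 1))).mul_left ((2 : ℝ) ^ (n.natAbs - (m - 1))))
      Metric.isOpen_ball (convex_ball (0 : ℝ) (|t| + 1)).isPreconnected (fun k s _ => ?_)
      (fun k s hs => ?_) ht (summable_negBinom_mul_divPow n m t) ht
    · simp only [show m - 1 + (k : ℤ) = m + k - 1 by ring]
      exact (hasDerivAt_divPow (m + k) s).const_mul _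
    · exact abs_negBinom_mul_divPow_le (by simp) (m - 1) k (by simpa using (mem_ball_zero_iff.1 hs).le)
  have he : HasDerivAt (fun s : ℝ => Real.exp (-s)) (-Real.exp (-t)) t := by
    simpa using (hasDerivAt_neg t).exp
  refine (he.mul hs).congr_deriv ?_
  rw [F_eq, F_eq]
  ring

theorem F_zero_of_pos (n : ℤ) {m : ℤ} (hm : 0 < m) : F n m 0 = 0 := by
  rw [F_eq, tsum_congr (g := fun _ => 0)]
  · simp
  · intro k
    rw [divPow_zero_right, if_neg (by omega), mul_zero]

theorem F_neg_natCast_zero (n : ℤ) (l : ℕ) : F n (-l) 0 = negBinom n l := by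
  rw [F_eq, tsum_eq_single l]
  · simp [divPow_zero_right]
  · intro k hk
    rw [divPow_zero_right, if_neg (by omega), mul_zero]

/-! ### The semigroup and the sum of transition probabilities -/

theorem generator_apply {N : ℕ} (f : Config N →ᵇ ℝ) (x : Config N) :
    generator N f x = ∑ j, (f (hop x j) - f x) := rfl

theorem exists_clm_eq_apply {N : ℕ} (f : Config N →ᵇ ℝ) (x : Config N) :
    ∃ ev : ((Config N →ᵇ ℝ) →L[ℝ] (Config N →ᵇ ℝ)) →L[ℝ] ℝ, ∀ A, ev A = A f x :=
  ⟨(BoundedContinuousFunction.evalCLM ℝ x).comp (ContinuousLinearMap.apply ℝ (Config N →ᵇ ℝ) f),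
    fun _ => rfl⟩

set_option maxSynthPendingDepth 5 in
theorem hasDerivAt_semigroup (N : ℕ) (t : ℝ) :
    HasDerivAt (semigroup N) (generator N * semigroup N t) t :=
  hasDerivAt_exp_smul_const' (𝕂 := ℝ) (generator N) t

theorem generator_mul_apply {N : ℕ} (A : (Config N →ᵇ ℝ) →L[ℝ] (Config N →ᵇ ℝ))
    (f : Config N →ᵇ ℝ) (x : Config N) :
    (generator N * A) f x = ∑ j, (A f (hop x j) - A f x) := rfl

theorem _root_.HasDerivAt.continuousLinearMap_apply {E : Type*} [NormedAddCommGroup E]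
    [NormedSpace ℝ E] (ev : E →L[ℝ] ℝ) {g : ℝ → E} {g' : E} {t : ℝ} (h : HasDerivAt g g' t) :
    HasDerivAt (fun s => ev (g s)) (ev g') t :=
  ev.hasFDerivAt.comp_hasDerivAt t h

set_option maxSynthPendingDepth 5 in
theorem hasDerivAt_semigroup_apply {N : ℕ} (f : Config N →ᵇ ℝ) (x : Config N) (t : ℝ) :
    HasDerivAt (fun s => semigroup N s f x)
      (∑ j, (semigroup N t f (hop x j) - semigroup N t f x)) t := by
  obtain ⟨ev, hev⟩ := exists_clm_eq_apply f x
  have h' := HasDerivAt.continuousLinearMap_apply ev (hasDerivAt_semigroup N t)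
  simp only [hev, generator_mul_apply] at h'
  exact h'

theorem semigroup_zero (N : ℕ) : semigroup N 0 = 1 := by
  simp [semigroup, NormedSpace.exp_zero]

set_option maxSynthPendingDepth 5 in
theorem hasSum_semigroup_apply {N : ℕ} (f : Config N →ᵇ ℝ) (x : Config N) (t : ℝ) :
    HasSum (fun n : ℕ => ((n.factorial : ℝ))⁻¹ * (t ^ n * (generator N ^ n) f x))
      (semigroup N t f x) := by
  have h := NormedSpace.exp_series_hasSum_exp' (𝕂 := ℝ) (t • generator N)
  obtain ⟨ev, hev⟩ := exists_clm_eq_apply f x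
  have h' := h.mapL ev
  simp only [hev, smul_pow] at h'
  exact h'

theorem norm_generator_pow_apply_le {N : ℕ} (n : ℕ) (f : Config N →ᵇ ℝ) (x : Config N) :
    |(generator N ^ n) f x| ≤ ‖generator N‖ ^ n * ‖f‖ := by
  refine (((generator N ^ n) f).norm_coe_le_norm x).trans ?_
  induction n with
  | zero => simp
  | succ n ih =>
    rw [pow_succ', pow_succ', mul_assoc]
    exact ((generator N).le_opNorm _).trans (mul_le_mul_of_nonneg_left ih (norm_nonneg _))

theorem abs_semigroup_apply_le {N : ℕ} {t : ℝ} (ht : 0 ≤ t) (f : Config N →ᵇ ℝ) (x : Config N) :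
    |semigroup N t f x| ≤ Real.exp (t * ‖generator N‖) * ‖f‖ := by
  rw [← (hasSum_semigroup_apply f x t).tsum_eq]
  have h := (NormedSpace.expSeries_div_hasSum_exp (t * ‖generator N‖)).mul_right ‖f‖
  rw [← Real.exp_eq_exp_ℝ] at h
  refine tsum_of_norm_bounded
    (f := fun n : ℕ => (n.factorial : ℝ)⁻¹ * (t ^ n * (generator N ^ n) f x)) h fun n => ?_
  rw [Real.norm_eq_abs, abs_mul, abs_mul, abs_inv, Nat.abs_cast, abs_of_nonneg (pow_nonneg ht n)]
  calc (n.factorial : ℝ)⁻¹ * (t ^ n * |(generator N ^ n) f x|)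
      ≤ (n.factorial : ℝ)⁻¹ * (t ^ n * (‖generator N‖ ^ n * ‖f‖)) := by
        gcongr
        exact norm_generator_pow_apply_le n f x
    _ = (t * ‖generator N‖) ^ n / n.factorial * ‖f‖ := by rw [mul_pow]; ring

/-- The semigroup preserves bounded pointwise convergence. -/
theorem tendsto_semigroup_apply {N : ℕ} {ι : Type*} {l : Filter ι} {f : ι → Config N →ᵇ ℝ}
    {g : Config N →ᵇ ℝ} {C : ℝ} (hC : ∀ i, ‖f i‖ ≤ C)
    (hf : ∀ x, Tendsto (fun i => f i x) l (𝓝 (g x))) (t : ℝ) (x : Config N) :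
    Tendsto (fun i => semigroup N t (f i) x) l (𝓝 (semigroup N t g x)) := by
  have hpow : ∀ (n : ℕ) x,
      Tendsto (fun i => (generator N ^ n) (f i) x) l (𝓝 ((generator N ^ n) g x)) := by
    intro n
    induction n with
    | zero => simpa using hf
    | succ n ih =>
      intro x
      simp only [pow_succ', ContinuousLinearMap.mul_def,
        ContinuousLinearMap.comp_apply, generator_apply]
      exact tendsto_finsetSum _ fun j _ => (ih _).sub (ih x)
  simp only [← (hasSum_semigroup_apply _ x t).tsum_eq]
  refine tendsto_tsum_of_dominated_convergence
    (bound := fun n : ℕ => (|t| * ‖generator N‖) ^ n / n.factorial * C)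
    ((Real.summable_pow_div_factorial _).mul_right C)
    (fun n => ((hpow n x).const_mul _).const_mul _) (Eventually.of_forall fun i n => ?_)
  rw [Real.norm_eq_abs, abs_mul, abs_mul, abs_inv, Nat.abs_cast, abs_pow]
  calc (n.factorial : ℝ)⁻¹ * (|t| ^ n * |(generator N ^ n) (f i) x|)
      ≤ (n.factorial : ℝ)⁻¹ * (|t| ^ n * (‖generator N‖ ^ n * C)) := by
        gcongr
        exact (norm_generator_pow_apply_le n (f i) x).trans (by gcongr; exact hC i)
    _ = (|t| * ‖generator N‖) ^ n / n.factorial * C := by rw [mul_pow]; ring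

/-- The indicator function of the configurations in `A`. -/
def indicator {N : ℕ} (A : Set (Config N)) : Config N →ᵇ ℝ :=
  BoundedContinuousFunction.ofNormedAddCommGroupDiscrete (A.indicator 1) 1
    (fun z => by by_cases h : z ∈ A <;> simp [h])

theorem indicator_apply {N : ℕ} (A : Set (Config N)) (x : Config N) :
    indicator A x = A.indicator 1 x := rfl

/-- Finite sums of indicators of points need not converge in norm to the indicator of `A`, but they
converge pointwise and stay bounded by `1`, which is what `tendsto_semigroup_apply` requires. -/
theorem hasSum_transitionProb {N : ℕ} (A : Set (Config N)) (t : ℝ) (y : Config N) :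
    HasSum (fun x : A => transitionProb x.1 t y) (semigroup N t (indicator A) y) := by
  classical
  have hval : ∀ (s : Finset A) (z : Config N), (∑ x ∈ s, single x.1) z
      = if ∃ x ∈ s, x.1 = z then 1 else 0 := by
    intro s z
    rw [BoundedContinuousFunction.coe_sum, Finset.sum_apply]
    change ∑ x ∈ s, (if z = x.1 then (1 : ℝ) else 0) = _
    split_ifs with h
    · obtain ⟨x, hx, rfl⟩ := h
      rw [Finset.sum_eq_single_of_mem x hx, if_pos rfl]
      exact fun b _ hb => if_neg fun e => hb (Subtype.ext e.symm)
    · exact Finset.sum_eq_zero fun x hx => if_neg fun e => h ⟨x, hx, e.symm⟩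
  have hsum : ∀ s : Finset A, ∑ x ∈ s, transitionProb x.1 t y
      = semigroup N t (∑ x ∈ s, single x.1) y := by
    intro s
    rw [map_sum, BoundedContinuousFunction.coe_sum, Finset.sum_apply]
    rfl
  unfold HasSum
  simp only [hsum]
  refine tendsto_semigroup_apply (C := 1) (fun s => ?_) (fun z => ?_) t y
  · refine (BoundedContinuousFunction.norm_le zero_le_one).2 fun z => ?_
    rw [hval]
    split_ifs <;> simp
  · simp only [hval, indicator_apply]
    by_cases hz : z ∈ A
    · refine tendsto_const_nhds.congr' ?_
      filter_upwards [eventually_ge_atTop {(⟨z, hz⟩ : A)}] with s hs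
      rw [if_pos ⟨⟨z, hz⟩, hs (by simp), rfl⟩]
      simp [hz]
    · refine tendsto_const_nhds.congr fun s => ?_
      rw [if_neg]
      · simp [hz]
      · rintro ⟨x, _, rfl⟩
        exact hz x.2

/-! ### Uniqueness for the backward equation -/

/-- Uniqueness for the backward equation among solutions of at most the growth of a weight that
a single hop can at most double. -/
theorem eq_zero_of_backward_equation {N : ℕ} {w : ℝ → Config N → ℝ} {W : Config N → ℝ} {C T : ℝ}
    (hW : ∀ x j, W (hop x j) ≤ 2 * W x) (hC : 0 ≤ C)
    (hw : ∀ t x, HasDerivAt (fun s => w s x) (∑ j, (w t (hop x j) - w t x)) t)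
    (h0 : ∀ x, w 0 x = 0) (hb : ∀ t ∈ Set.Icc 0 T, ∀ x, |w t x| ≤ C * W x)
    {t : ℝ} (ht : t ∈ Set.Icc 0 T) (x : Config N) : w t x = 0 := by
  -- Picard iteration: each of the `N` terms of the derivative costs a factor `3 = 2 + 1`, namely
  -- `2` for the weight after the hop and `1` for the weight before it. Integrating in time supplies
  -- the factorial.
  have key : ∀ n : ℕ, ∀ x, ∀ t ∈ Set.Icc 0 T,
      |w t x| ≤ C * W x * ((3 * N * t) ^ n / n.factorial) := by
    intro n
    induction n with
    | zero => intro x t ht; simpa using hb t ht x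
    | succ n ih =>
      intro x t ht
      have hB : ∀ s : ℝ, HasDerivAt
          (fun s : ℝ => C * W x * ((3 * N * s) ^ (n + 1) / (n + 1).factorial))
          (C * W x * (3 * N * (3 * N * s) ^ n / n.factorial)) s := by
        intro s
        have h1 : HasDerivAt (fun s : ℝ => 3 * N * s) (3 * N) s := by
          simpa using (hasDerivAt_id s).const_mul (3 * N : ℝ)
        refine (((h1.pow (n + 1)).div_const _).const_mul (C * W x)).congr_deriv ?_
        rw [Nat.factorial_succ]
        push_cast
        field_simp
      refine image_norm_le_of_norm_deriv_right_le_deriv_boundary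
        (f := fun s => w s x) (f' := fun s => ∑ j, (w s (hop x j) - w s x))
        (fun s _ => (hw s x).continuousAt.continuousWithinAt)
        (fun s _ => (hw s x).hasDerivWithinAt) (by simp [h0]) hB (fun s hs => ?_) ht
      have hs' : s ∈ Set.Icc 0 T := Set.Ico_subset_Icc_self hs
      have hs0 : 0 ≤ s := hs.1
      set q : ℝ := (3 * N * s) ^ n / n.factorial with hq
      have hq0 : 0 ≤ q := by positivity
      calc ‖∑ j, (w s (hop x j) - w s x)‖ ≤ ∑ _j : Fin N, 3 * (C * W x * q) := by
            refine norm_sum_le_of_le _ fun j _ => ?_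
            have h1 := ih (hop x j) s hs'
            have h2 := ih x s hs'
            have h3 : C * W (hop x j) * q ≤ C * (2 * W x) * q := by
              gcongr
              exact hW x j
            have h4 := abs_sub (w s (hop x j)) (w s x)
            rw [Real.norm_eq_abs]
            linarith
        _ = C * W x * (3 * N * (3 * N * s) ^ n / n.factorial) := by
            rw [hq]
            simp
            ring
  have hlim : Tendsto (fun n : ℕ => C * W x * ((3 * N * t) ^ n / n.factorial)) atTop (𝓝 0) := by
    simpa using (FloorSemiring.tendsto_pow_div_factorial_atTop (3 * N * t)).const_mul (C * W x)
  exact abs_nonpos_iff.1 (ge_of_tendsto' hlim fun n => key n x t ht)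

/-! ### General facts on determinants -/

theorem _root_.HasDerivAt.matrix_det {n : Type*} [Fintype n] [DecidableEq n]
    {M : ℝ → Matrix n n ℝ} {M' : Matrix n n ℝ} {t : ℝ}
    (h : ∀ i j, HasDerivAt (fun s => M s i j) (M' i j) t) :
    HasDerivAt (fun s => (M s).det) (∑ i, ((M t).updateRow i (M' i)).det) t := by
  have hdet : ∀ A : Matrix n n ℝ,
      A.det = ∑ σ : Equiv.Perm n, (Equiv.Perm.sign σ : ℤ) * ∏ i, A i (σ i) := by
    intro A
    rw [← Matrix.det_transpose, Matrix.det_apply']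
    rfl
  simp only [hdet]
  rw [Finset.sum_comm]
  refine HasDerivAt.fun_sum fun σ _ => ?_
  refine ((HasDerivAt.fun_finsetProd fun i _ => h i (σ i)).const_mul _).congr_deriv ?_
  rw [Finset.mul_sum]
  refine Finset.sum_congr rfl fun i _ => ?_
  rw [← Finset.prod_erase_mul Finset.univ _ (Finset.mem_univ i), Matrix.updateRow_self, smul_eq_mul]
  congr 2
  refine Finset.prod_congr rfl fun j hj => ?_
  rw [Matrix.updateRow_ne (Finset.ne_of_mem_erase hj)]

/-- The zero block has `j + 1` rows and `N - j` columns, together more than `N`. By pigeonhole no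
permutation sends all columns of the block to rows outside it. -/
theorem _root_.Matrix.det_eq_zero_of_corner_eq_zero {N : ℕ} {R : Type*} [CommRing R]
    {M : Matrix (Fin N) (Fin N) R} (j : Fin N) (h : ∀ i k, i ≤ j → j ≤ k → M i k = 0) :
    M.det = 0 := by
  rw [Matrix.det_apply]
  refine Finset.sum_eq_zero fun σ _ => ?_
  obtain ⟨k, hk, hσ⟩ : ∃ k, j ≤ k ∧ σ k ≤ j := by
    by_contra! hcon
    have hcard := Finset.card_le_card_of_injOn (s := Finset.Ici j) (t := Finset.Ioi j) σ
      (fun k hk => by simpa using hcon k (by simpa using hk)) σ.injective.injOn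
    rw [Fin.card_Ici, Fin.card_Ioi] at hcard
    omega
  have hprod : ∏ i, M (σ i) i = 0 := Finset.prod_eq_zero (Finset.mem_univ k) (h _ _ hσ hk)
  rw [hprod, smul_zero]

theorem _root_.Matrix.abs_det_le_of_row_bound {n : Type*} [Fintype n] [DecidableEq n]
    {M : Matrix n n ℝ} {r : n → ℝ} (h : ∀ i j, |M i j| ≤ r i) :
    |M.det| ≤ (Fintype.card n).factorial * ∏ i, r i := by
  rw [Matrix.det_apply']
  calc |∑ σ : Equiv.Perm n, ((Equiv.Perm.sign σ : ℤ) : ℝ) * ∏ i, M (σ i) i|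
      ≤ ∑ _σ : Equiv.Perm n, ∏ i, r i := by
        refine (Finset.abs_sum_le_sum_abs _ _).trans (Finset.sum_le_sum fun σ _ => ?_)
        rw [abs_mul, Finset.abs_prod, ← Equiv.prod_comp σ r]
        have hs : |((Equiv.Perm.sign σ : ℤ) : ℝ)| = 1 := by
          rcases Int.units_eq_one_or (Equiv.Perm.sign σ) with h | h <;> simp [h]
        rw [hs, one_mul]
        exact Finset.prod_le_prod (fun _ _ => abs_nonneg _) fun i _ => h _ _
    _ = (Fintype.card n).factorial * ∏ i, r i := by
        rw [Finset.sum_const, Finset.card_univ, Fintype.card_perm, nsmul_eq_mul]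

/-! ### Evolution and initial value of the determinant -/

/-- The matrix `F_{k-j+1}(X_k - y_j; t)`, for arbitrary integer vectors `X` and `y`. -/
def transitionMatrix {N : ℕ} (X y : Fin N → ℤ) (t : ℝ) : Matrix (Fin N) (Fin N) ℝ :=
  Matrix.of fun j k => F ((k : ℤ) - (j : ℤ) + 1) (X k - y j) t

theorem transitionMatrix_apply {N : ℕ} (X y : Fin N → ℤ) (t : ℝ) (j k : Fin N) :
    transitionMatrix X y t j k = F ((k : ℤ) - (j : ℤ) + 1) (X k - y j) t := rfl

theorem Blocked.succ_val {N : ℕ} {y : Config N} {i j : Fin N} (h : y.1 i = y.1 j + 1) :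
    (i : ℕ) = j + 1 := by
  have hji : j < i := y.2.lt_iff_lt.1 (by omega)
  by_contra hne
  have hlt : (j : ℕ) + 1 < i := by
    have : (j : ℕ) < i := hji
    omega
  let k : Fin N := ⟨j + 1, hlt.trans i.2⟩
  have h1 : y.1 j < y.1 k := y.2 (Fin.lt_def.2 (Nat.lt_succ_self _))
  have h2 : y.1 k < y.1 i := y.2 (Fin.lt_def.2 hlt)
  omega

theorem transitionMatrix_update {N : ℕ} (X y : Fin N → ℤ) (t : ℝ) (j : Fin N) :
    transitionMatrix X (Function.update y j (y j + 1)) t =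
      (transitionMatrix X y t).updateRow j
        fun k => F ((k : ℤ) - (j : ℤ) + 1) (X k - y j - 1) t := by
  ext i k
  by_cases h : i = j
  · subst h
    rw [transitionMatrix_apply, Matrix.updateRow_self, Function.update_self]
    congr 1
    ring
  · rw [transitionMatrix_apply, Matrix.updateRow_ne h, Function.update_of_ne h,
      transitionMatrix_apply]

/-- The increment of the determinant when particle `j` attempts to hop. -/
theorem det_transitionMatrix_hop_sub {N : ℕ} (X : Fin N → ℤ) (y : Config N) (t : ℝ) (j : Fin N) :
    ((transitionMatrix X y.1 t).updateRow j fun k =>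
        F ((k : ℤ) - (j : ℤ) + 1) (X k - y.1 j - 1) t -
          F ((k : ℤ) - (j : ℤ) + 1) (X k - y.1 j) t).det =
      (transitionMatrix X (hop y j).1 t).det - (transitionMatrix X y.1 t).det := by
  by_cases h : Blocked y j
  · rw [show hop y j = y from dif_pos h, sub_self]
    obtain ⟨i, hi⟩ := h
    have hij : i ≠ j := by
      rintro rfl
      omega
    have hv := Blocked.succ_val hi
    -- Here `i = j + 1`: the recurrence lowers the index of `F` by one, which matches both the row
    -- shift and `y_i = y_j + 1`.
    refine Matrix.det_zero_of_row_eq hij ?_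
    ext k
    rw [Matrix.updateRow_ne hij, Matrix.updateRow_self, transitionMatrix_apply, hi, hv]
    have h1 := F_sub_F_add_one ((k : ℤ) - (j : ℤ) + 1) (X k - y.1 j - 1) t
    rw [sub_add_cancel] at h1
    rw [h1]
    push_cast
    congr 1 <;> ring
  · rw [show hop y j = ⟨Function.update y.1 j (y.1 j + 1), strictMono_update y j h⟩ from dif_neg h,
      transitionMatrix_update, eq_sub_iff_add_eq]
    nth_rw 2 [← Matrix.updateRow_eq_self (transitionMatrix X y.1 t) j]
    rw [← Matrix.det_updateRow_add]
    congr 2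
    ext k
    rw [Pi.add_apply, transitionMatrix_apply, sub_add_cancel]

theorem hasDerivAt_det_transitionMatrix {N : ℕ} (X : Fin N → ℤ) (y : Config N) (t : ℝ) :
    HasDerivAt (fun s => (transitionMatrix X y.1 s).det)
      (∑ j, ((transitionMatrix X (hop y j).1 t).det - (transitionMatrix X y.1 t).det)) t := by
  simp only [← det_transitionMatrix_hop_sub]
  exact HasDerivAt.matrix_det (M := transitionMatrix X y.1)
    (M' := fun j k => F ((k : ℤ) - (j : ℤ) + 1) (X k - y.1 j - 1) t -
      F ((k : ℤ) - (j : ℤ) + 1) (X k - y.1 j) t)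
    fun j k => hasDerivAt_F _ _ t

theorem apply_add_sub_le {N : ℕ} (y : Config N) {j k : Fin N} (h : k ≤ j) :
    y.1 k + ((j : ℤ) - k) ≤ y.1 j := by
  obtain ⟨j, hj⟩ := j
  obtain ⟨k, hk⟩ := k
  have h' : k ≤ j := h
  clear h
  induction j, h' using Nat.le_induction with
  | base => simp
  | succ j hkj ih =>
    have h1 := ih (by omega)
    have h2 : y.1 ⟨j, by omega⟩ < y.1 ⟨j + 1, hj⟩ := y.2 (Fin.lt_def.2 (Nat.lt_succ_self _))
    push_cast at h1 ⊢
    omega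

/-- The configurations in which every particle `j` is at `X j` or to the right of it. -/
def upperSet {N : ℕ} (X : Fin N → ℤ) : Set (Config N) := {x | ∀ j, X j ≤ x.1 j}

theorem det_transitionMatrix_zero {N : ℕ} {X : Fin N → ℤ} (hX : Monotone X) (y : Config N) :
    (transitionMatrix X y.1 0).det = indicator (upperSet X) y := by
  rw [indicator_apply]
  by_cases hy : y ∈ upperSet X
  · rw [Set.indicator_of_mem hy, Pi.one_apply, Matrix.det_of_isUpperTriangular]
    · refine Finset.prod_eq_one fun j _ => ?_
      obtain ⟨l, hl⟩ := Int.eq_ofNat_of_zero_le (sub_nonneg.2 (hy j))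
      rw [transitionMatrix_apply, show X j - y.1 j = -(l : ℤ) by omega, F_neg_natCast_zero, sub_self,
        zero_add, negBinom_one_left]
    · intro j k hkj
      -- Below the diagonal the index is `-p` with `p = j - k - 1`, whereas `l = y_j - X_k ≥ y_j -
      -- y_k ≥ j - k > p`, so the coefficient `(-p)_l / l!` vanishes.
      have hkj' : k < j := hkj
      have h1 := apply_add_sub_le y hkj'.le
      have h2 := hy k
      have h3 : (k : ℕ) < j := hkj'
      obtain ⟨l, hl⟩ := Int.eq_ofNat_of_zero_le (a := y.1 j - X k) (by omega)
      obtain ⟨p, hp⟩ := Int.eq_ofNat_of_zero_le (a := (j : ℤ) - k - 1) (by omega)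
      rw [transitionMatrix_apply, show X k - y.1 j = -(l : ℤ) by omega,
        show (k : ℤ) - j + 1 = -(p : ℤ) by omega, F_neg_natCast_zero, negBinom_neg_of_lt (by omega)]
  · rw [Set.indicator_of_notMem hy]
    simp only [upperSet, Set.mem_ofPred_eq, not_forall, not_le] at hy
    obtain ⟨j, hj⟩ := hy
    -- For `i ≤ j ≤ k`, `y_i ≤ y_j < X_j ≤ X_k`; the last inequality is where monotonicity of `X`
    -- enters.
    refine Matrix.det_eq_zero_of_corner_eq_zero j fun i k hij hjk => ?_
    have h1 := y.2.monotone hij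
    have h2 := hX hjk
    rw [transitionMatrix_apply, F_zero_of_pos _ (by omega)]

/-! ### Growth bound and identification with the semigroup -/

/-- A weight on configurations that bounds the growth of `transitionMatrix`. -/
def weight {N : ℕ} (y : Config N) : ℝ := ∏ j, (1 + (2 : ℝ) ^ y.1 j)

/-- The summand `1` in each factor of the weight lets it dominate bounded functions too, in
particular the semigroup side. -/
theorem one_le_weight {N : ℕ} (y : Config N) : 1 ≤ weight y := by
  have h := Finset.prod_le_prod (s := Finset.univ) (f := fun _ : Fin N => (1 : ℝ))
    (g := fun j => 1 + (2 : ℝ) ^ y.1 j) (fun _ _ => zero_le_one)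
    fun j _ => le_add_of_nonneg_right (by positivity)
  simpa [weight] using h

theorem weight_hop_le {N : ℕ} (y : Config N) (j : Fin N) : weight (hop y j) ≤ 2 * weight y := by
  by_cases h : Blocked y j
  · rw [show hop y j = y from dif_pos h]
    linarith [one_le_weight y]
  · rw [show hop y j = ⟨Function.update y.1 j (y.1 j + 1), strictMono_update y j h⟩ from dif_neg h,
      weight, weight, ← Finset.mul_prod_erase _ _ (Finset.mem_univ j),
      ← Finset.mul_prod_erase _ (fun i => 1 + (2 : ℝ) ^ y.1 i) (Finset.mem_univ j), ← mul_assoc]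
    dsimp only
    have herase : ∏ i ∈ Finset.univ.erase j, (1 + (2 : ℝ) ^ Function.update y.1 j (y.1 j + 1) i) =
        ∏ i ∈ Finset.univ.erase j, (1 + (2 : ℝ) ^ y.1 i) :=
      Finset.prod_congr rfl fun i hi => by
        rw [Function.update_of_ne (Finset.ne_of_mem_erase hi)]
    rw [herase]
    refine mul_le_mul_of_nonneg_right ?_ (Finset.prod_nonneg fun i _ => by positivity)
    rw [Function.update_self, zpow_add_one₀ two_ne_zero]
    linarith

theorem exists_abs_det_transitionMatrix_le {N : ℕ} (X : Fin N → ℤ) (T : ℝ) :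
    ∃ C : ℝ, 0 ≤ C ∧ ∀ t ∈ Set.Icc 0 T, ∀ y : Config N,
      |(transitionMatrix X y.1 t).det| ≤ C * weight y := by
  set c : ℝ := (∑ k, (2 : ℝ) ^ ((N : ℤ) - X k)) * Real.exp T
  have hc : 0 ≤ c := by positivity
  refine ⟨N.factorial * c ^ N, by positivity, fun t ht y => ?_⟩
  -- The bound on an entry depends on `y` only through its row, so the Leibniz expansion reproduces
  -- the product `weight y`.
  have hentry : ∀ j k, |transitionMatrix X y.1 t j k| ≤ c * (1 + (2 : ℝ) ^ y.1 j) := by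
    intro j k
    have hn : |(k : ℤ) - (j : ℤ) + 1| ≤ (N : ℕ) := by
      rw [abs_le]
      omega
    calc |transitionMatrix X y.1 t j k|
        ≤ (2 : ℝ) ^ ((N : ℤ) - (X k - y.1 j)) * Real.exp t := abs_F_le hn _ ht.1
      _ = (2 : ℝ) ^ ((N : ℤ) - X k) * Real.exp t * 2 ^ y.1 j := by
          rw [show (N : ℤ) - (X k - y.1 j) = (N - X k) + y.1 j by ring, zpow_add₀ two_ne_zero]
          ring
      _ ≤ c * (1 + (2 : ℝ) ^ y.1 j) := by
          have h1 : (2 : ℝ) ^ ((N : ℤ) - X k) ≤ ∑ k, (2 : ℝ) ^ ((N : ℤ) - X k) :=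
            Finset.single_le_sum (f := fun k => (2 : ℝ) ^ ((N : ℤ) - X k))
              (fun _ _ => by positivity) (Finset.mem_univ k)
          have h2 : Real.exp t ≤ Real.exp T := Real.exp_le_exp.2 ht.2
          exact mul_le_mul (mul_le_mul h1 h2 (by positivity) (by positivity)) (by linarith)
            (by positivity) hc
  refine (Matrix.abs_det_le_of_row_bound hentry).trans_eq ?_
  rw [Finset.prod_mul_distrib, Finset.prod_const, Finset.card_univ, Fintype.card_fin, weight,
    mul_assoc]

theorem semigroup_indicator_eq_det {N : ℕ} {X : Fin N → ℤ} (hX : Monotone X) {t : ℝ} (ht : 0 ≤ t)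
    (y : Config N) :
    semigroup N t (indicator (upperSet X)) y = (transitionMatrix X y.1 t).det := by
  obtain ⟨C, hC, hdet⟩ := exists_abs_det_transitionMatrix_le X t
  set f := indicator (upperSet X)
  set D : ℝ := Real.exp (t * ‖generator N‖) * ‖f‖
  refine (sub_eq_zero.1 (eq_zero_of_backward_equation (W := weight) (C := C + D) (T := t)
    (w := fun s x => (transitionMatrix X x.1 s).det - semigroup N s f x) weight_hop_le
    (by positivity) (fun s x => ?_) (fun x => ?_) (fun s hs x => ?_) ⟨ht, le_rfl⟩ y)).symm
  · refine ((hasDerivAt_det_transitionMatrix X x s).sub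
      (hasDerivAt_semigroup_apply f x s)).congr_deriv ?_
    rw [← Finset.sum_sub_distrib]
    exact Finset.sum_congr rfl fun j _ => by ring
  · rw [det_transitionMatrix_zero hX, semigroup_zero]
    exact sub_self _
  · have h1 := hdet s hs x
    have h2 : |semigroup N s f x| ≤ D := by
      refine (abs_semigroup_apply_le hs.1 f x).trans ?_
      exact mul_le_mul_of_nonneg_right (Real.exp_le_exp.2
        (mul_le_mul_of_nonneg_right hs.2 (generator N).opNorm_nonneg)) (norm_nonneg _)
    have h3 : D ≤ D * weight x := le_mul_of_one_le_right (by positivity) (one_le_weight x)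
    have h4 := abs_sub (transitionMatrix X x.1 s).det (semigroup N s f x)
    linarith

/-! ### Realizations of the process -/

/-- Take expectations in the Markov property at time `0`, where the state is almost surely `y`. -/
theorem IsProcess.measureReal_preimage {Ω : Type*} [MeasurableSpace Ω] {μ : Measure Ω}
    [IsProbabilityMeasure μ] {N : ℕ} {y : Config N} {η : ℝ≥0 → Ω → Config N}
    (h : IsProcess μ y η) {A : Set (Config N)} (hA : MeasurableSet A) (t : ℝ≥0) :
    μ.real (η t ⁻¹' A) = semigroup N t (indicator A) y := by
  have hm : (⨆ r ∈ Set.Iic (0 : ℝ≥0), MeasurableSpace.comap (η r) inferInstance) ≤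
      (inferInstance : MeasurableSpace Ω) :=
    iSup₂_le fun r _ => (h.measurable r).comap_le
  have h1 := integral_congr_ae (h.markov 0 t (indicator A))
  rw [integral_condExp hm, zero_add] at h1
  have h2 : ∫ ω, indicator A (η t ω) ∂μ = μ.real (η t ⁻¹' A) := by
    rw [← integral_indicator_one (h.measurable t hA)]
    rfl
  have h3 : (fun ω => semigroup N t (indicator A) (η 0 ω)) =ᵐ[μ]
      fun _ => semigroup N t (indicator A) y := by
    filter_upwards [h.initial] with ω hω
    rw [hω]
  rw [← h2, h1, integral_congr_ae h3]
  simp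

theorem measurableSet_upperSet {N : ℕ} (X : Fin N → ℤ) : MeasurableSet (upperSet X) := by
  rw [upperSet, Set.ofPred_forall]
  exact MeasurableSet.iInter fun j =>
    measurableSet_le measurable_const ((measurable_pi_apply j).comp measurable_subtype_coe)

end TASEP

end

theorem proposition1 (N : ℕ) (y : TASEP.Config N) (X : Fin N → ℤ) (hX : Monotone X)
    (t : ℝ≥0) :
    HasSum (fun x : {x : TASEP.Config N // ∀ j, X j ≤ x.1 j} =>
        TASEP.transitionProb x.1 t y)
      (Matrix.det (Matrix.of fun j k : Fin N =>
        TASEP.F ((k : ℤ) - (j : ℤ) + 1) (X k - y.1 j) t)) ∧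
    ∀ {Ω : Type*} [MeasurableSpace Ω] (μ : Measure Ω) [IsProbabilityMeasure μ]
      (η : ℝ≥0 → Ω → TASEP.Config N), TASEP.IsProcess μ y η →
      μ.real {ω | ∀ j, X j - y.1 j ≤ (η t ω).1 j - y.1 j} =
        Matrix.det (Matrix.of fun j k : Fin N =>
          TASEP.F ((k : ℤ) - (j : ℤ) + 1) (X k - y.1 j) t) := by
  have h := TASEP.semigroup_indicator_eq_det hX t.2 y
  refine ⟨?_, fun μ _ η hη => ?_⟩
  · exact h ▸ TASEP.hasSum_transitionProb (TASEP.upperSet X) t y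
  · simp only [sub_le_sub_iff_right]
    exact (hη.measureReal_preimage (TASEP.measurableSet_upperSet X) t).trans h
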